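/- Let $p \ge 0$ be fixed, let $\|\cdot\|$ be any norm on $\mathbb{R}^p$, and let $\Sigma$ be a positive definite $p\times p$ matrix. Consider the exponential family of densities $$f(y;\theta,\phi)=\exp\{(y\theta-b(\theta))/a(\phi)+c(y,\phi)\}$$ with respect to a $\sigma$-finite measure on $\mathbb{R}$ (for example Lebesgue measure or a counting measure). (i) Let $Y_1,Y_2,\dots$ be i.i.d. with density $f(\cdot;\theta,\phi)$ for some fixed $(\theta,\phi)$, with finite variance $\xi>0$. Let $\mathbf{x}_1,\mathbf{x}_2,\dots$ be i.i.d. random vectors in $\mathbb{R}^p$ with finite second moments and covariance matrix $\Sigma$, independent of $(Y_n)_{n}$. For $N\ge 1$ let $X$ be the $N\times p$ matrix with rows $\mathbf{x}_1^{\rm T},\dots,\mathbf{x}_N^{\rm T}$, let $\mathbf{Y}=(Y_1,\dots,Y_N)^{\rm T}$, $\bar Y=\frac1N\sum_{n=1}^N Y_n$ and $\mathbf{1}=(1,\dots,1)^{\rm T}\in\mathbb{R}^N$, and let $\hat\xi=\hat\xi_N$ be random variables with $\hat\xi_N\to\xi$ in probability. Then, as $N\to\infty$, $$T(\mathbf{Y})=\frac{\|X^{\rm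 T}(\mathbf{Y}-\bar Y\mathbf{1})\|}{\sqrt{N\hat\xi}}\;\xrightarrow{d}\;\|\mathbf{W}\|,\qquad \mathbf{W}\sim \mathrm{N}(0,\Sigma).$$ (ii) Consequently $T(\mathbf{Y})$ is asymptotically pivotal under $H_0:\boldsymbol\beta=\mathbf{0}$ in the following sense. Consider a generalized linear model with link function $g$ and parameters $(\beta_0,\boldsymbol\beta,\phi)$: the pairs $(\mathbf{x}_n,Y_n)$ are independent, the $\mathbf{x}_n$ are identically distributed, and given $\mathbf{x}_n$ the response $Y_n$ has density $f(\cdot;\theta_n,\phi)$ with $\theta_n$ a function of $\mathbf{x}_n$ such that $E[Y_n\mid\mathbf{x}_n]=g^{-1}(\beta_0+\mathbf{x}_n^{\rm T}\boldsymbol\beta)$. Suppose that, for every parameter of the model with $\boldsymbol\beta=\mathbf{0}$, the covariates have finite second moments and covariance matrix $\Sigma$, the responses have a finite positive variance, and the same $\hat\xi$ is consistent for that variance. Then under every such parameter $T(\mathbf{Y})\to_d\|\mathbf{W}\|$; in particular the limit law is the same for all values of the nuisance parameters $\beta_0$ and $\phi$. -/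

import Mathlib

open MeasureTheory ProbabilityTheory Filter Topology
open scoped Matrix

/-- The data of an exponential (dispersion) family of distributions on `ℝ`: densities
`exp ((y θ - b θ) / a φ + c y φ)` with respect to a dominating measure `base`
(for instance Lebesgue measure, or a counting measure on the support). -/
structure ExpFamily where
  /-- the dominating measure -/
  base : Measure ℝ
  sigmaFinite_base : SigmaFinite base
  /-- the dispersion function -/
  a : ℝ → ℝ
  /-- the cumulant function -/
  b : ℝ → ℝ
  /-- the normalising term -/
  c : ℝ → ℝ → ℝ
  measurable_b : Measurable b
  measurable_c : ∀ φ, Measurable fun y => c y φ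

/-- The density `f(y; θ, φ)`. -/
noncomputable def ExpFamily.density (F : ExpFamily) (θ φ y : ℝ) : ℝ :=
  Real.exp ((y * θ - F.b θ) / F.a φ + F.c y φ)

/-- The measure on `ℝ` with density `f(·; θ, φ)`. It is a probability measure exactly when
`(θ, φ)` is an admissible parameter. -/
noncomputable def ExpFamily.law (F : ExpFamily) (θ φ : ℝ) : Measure ℝ :=
  F.base.withDensity fun y => ENNReal.ofReal (F.density θ φ y)

/-- The `N × p` matrix of covariates whose rows are the first `N` covariate vectors. -/
def designMatrix {Ω : Type*} {p : ℕ} (X : ℕ → Ω → EuclideanSpace ℝ (Fin p)) (N : ℕ) (ω : Ω) :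
    Matrix (Fin N) (Fin p) ℝ :=
  Matrix.of fun n j => X n ω j

/-- The vector of the first `N` responses. -/
def responseVector {Ω : Type*} (Y : ℕ → Ω → ℝ) (N : ℕ) (ω : Ω) : Fin N → ℝ :=
  fun n => Y n ω

/-- The arithmetic mean of a vector. -/
noncomputable def vectorMean {N : ℕ} (y : Fin N → ℝ) : ℝ :=
  (∑ n, y n) / N

/-- The test statistic `T = ‖Xᵀ (Y - Ȳ 1)‖ / √(N ξ̂)`, for a norm `nrm` on `ℝᵖ`. -/
noncomputable def glmStatistic {Ω : Type*} {p : ℕ}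
    (nrm : Seminorm ℝ (EuclideanSpace ℝ (Fin p)))
    (X : ℕ → Ω → EuclideanSpace ℝ (Fin p)) (Y : ℕ → Ω → ℝ) (xiHat : ℕ → Ω → ℝ)
    (N : ℕ) (ω : Ω) : ℝ :=
  nrm (WithLp.toLp 2 ((designMatrix X N ω)ᵀ *ᵥ
      (responseVector Y N ω - vectorMean (responseVector Y N ω) • (1 : Fin N → ℝ))))
    / √((N : ℝ) * xiHat N ω)

/-- The random vector `V` is square integrable and has covariance matrix `S`. -/
def HasCovMatrix {Ω : Type*} [MeasurableSpace Ω] {p : ℕ}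
    (V : Ω → EuclideanSpace ℝ (Fin p)) (S : Matrix (Fin p) (Fin p) ℝ) (μ : Measure Ω) : Prop :=
  MemLp V 2 μ ∧ ∀ i j, cov[fun ω => V ω i, fun ω => V ω j; μ] = S i j

/-- The observations `(Xₙ, Yₙ)` are independent, the covariate vectors `Xₙ` are identically
distributed, every `Yₙ` is independent of `Xₙ` and follows the member `(θ, φ)` of the family. -/
structure IsIIDExpSample {Ω : Type*} [MeasurableSpace Ω] {p : ℕ} (F : ExpFamily) (θ φ : ℝ)
    (X : ℕ → Ω → EuclideanSpace ℝ (Fin p)) (Y : ℕ → Ω → ℝ) (μ : Measure Ω) : Prop where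
  indep : iIndepFun (fun n ω => (X n ω, Y n ω)) μ
  ident_covariates : ∀ n, IdentDistrib (X n) (X 0) μ μ
  indep_covariates_response : ∀ n, IndepFun (X n) (Y n) μ
  law_response : ∀ n, HasLaw (Y n) (F.law θ φ) μ

/-- Parameters of a generalized linear model: intercept `β₀`, slopes `β`, dispersion `φ`. -/
structure GLMParam (p : ℕ) where
  intercept : ℝ
  slope : EuclideanSpace ℝ (Fin p)
  dispersion : ℝ

/-- Under `μ`, the data `(Xₙ, Yₙ)` follow the generalized linear model with link function `g`
(a bijection from a set of means onto a set of linear predictors) and parameter `π`: the pairs are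
independent, the covariates identically distributed, and given `Xₙ = x` the response has the
density `f(·; θₙ(x), φ)`, where `θₙ(x)` is such that the mean of this density is
`g⁻¹ (β₀ + xᵀ β)`. -/
structure IsGLM {Ω : Type*} [MeasurableSpace Ω] {p : ℕ} (F : ExpFamily) (g : PartialEquiv ℝ ℝ)
    (X : ℕ → Ω → EuclideanSpace ℝ (Fin p)) (Y : ℕ → Ω → ℝ) (π : GLMParam p)
    (μ : Measure Ω) : Prop where
  indep : iIndepFun (fun n ω => (X n ω, Y n ω)) μ
  ident_covariates : ∀ n, IdentDistrib (X n) (X 0) μ μ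
  aemeasurable_response : ∀ n, AEMeasurable (Y n) μ
  conditional_response : ∀ n, ∃ θ : EuclideanSpace ℝ (Fin p) → ℝ, Measurable θ ∧
    μ.map (fun ω => (X n ω, Y n ω)) =
      ((μ.map (X n)).prod F.base).withDensity
        (fun z => ENNReal.ofReal (F.density (θ z.1) π.dispersion z.2)) ∧
    ∀ᵐ x ∂(μ.map (X n)),
      Integrable (fun y : ℝ => y) (F.law (θ x) π.dispersion) ∧
      π.intercept + inner ℝ x π.slope ∈ g.target ∧
      ∫ y, y ∂(F.law (θ x) π.dispersion) = g.symm (π.intercept + inner ℝ x π.slope)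

/-- The null hypothesis `β = 0` within a parameter set. -/
def nullHypothesis {p : ℕ} (Θ : Set (GLMParam p)) : Set (GLMParam p) :=
  {π ∈ Θ | π.slope = 0}

/-- A sequence of statistics is asymptotically pivotal over a set `S` of parameters if it converges
in distribution, under every parameter in `S`, to one and the same probability law. -/
def AsymptoticallyPivotal {Ω Par : Type*} [MeasurableSpace Ω] (Pr : Par → ProbabilityMeasure Ω)
    (S : Set Par) (T : ℕ → Ω → ℝ) : Prop :=
  ∃ ρ : ProbabilityMeasure ℝ, ∀ π ∈ S,
    TendstoInDistribution T atTop (fun x : ℝ => x) (fun _ => (Pr π : Measure Ω)) (ρ : Measure ℝ)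

/-! Put `Z n = X n - E[X 0]` and `U n = (Y n - E[Y 0]) / √ξ`. Subtracting the sample mean of the
responses makes the mean of the covariates drop out, so the statistic is the norm of `N^(-1/2) ∑ U k
• Z k - Ū • N^(-1/2) ∑ Z k`, times `√ξ / √ξ̂` (`glmStatistic_eq`). The products `U k • Z k` are
i.i.d. and centred with covariance `S`, since `U` is standardized and independent of `Z`
(`HasCovMatrix.smul_of_indepFun`); the central limit theorem gives the Gaussian limit. The second
term vanishes because `Ū → 0` while its other factor converges in law, and Slutsky's theorem
concludes.

For the generalized linear model, zero slope makes the conditional mean of the response constant. At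
fixed dispersion the mean determines the member of the family (`ExpFamily.law_eq_of_integral_eq`),
so the conditional law is constant too. Hence responses are identically distributed and independent
of the covariates, and the i.i.d. case applies, with a limit that depends only on `S` and the norm.
-/

/-- Every seminorm on a Euclidean space is continuous. -/
lemma Seminorm.continuous_euclideanSpace {p : ℕ}
    (q : Seminorm ℝ (EuclideanSpace ℝ (Fin p))) : Continuous q :=
  continuousOn_univ.1 (q.convexOn.continuousOn isOpen_univ)

/-- Convergence in probability to a constant is preserved by maps continuous at the constant. -/
lemma MeasureTheory.TendstoInMeasure.comp_continuousAt_const {α ι E F : Type*} [MeasurableSpace α]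
    [PseudoEMetricSpace E] [PseudoEMetricSpace F] {μ : Measure α} {l : Filter ι}
    {f : ι → α → E} {c : E} {h : E → F} (hf : TendstoInMeasure μ f l fun _ => c)
    (hh : ContinuousAt h c) : TendstoInMeasure μ (fun i x => h (f i x)) l fun _ => h c := by
  intro ε hε
  obtain ⟨δ, hδ, H⟩ := EMetric.tendsto_nhds_nhds.1 hh ε hε
  refine tendsto_of_tendsto_of_tendsto_of_le_of_le tendsto_const_nhds (hf δ hδ)
    (fun _ => zero_le) fun i => measure_mono fun x hx => ?_
  simp only [Set.mem_ofPred_eq] at hx ⊢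
  by_contra! hlt
  exact absurd (H hlt) (not_lt.2 hx)

/-- Convergence in distribution to the constant `0` implies convergence in probability. -/
lemma MeasureTheory.TendstoInDistribution.tendstoInMeasure_zero {Ω Ω' E : Type*}
    [MeasurableSpace Ω] [MeasurableSpace Ω'] {μ : Measure Ω} {μ' : Measure Ω'}
    [IsProbabilityMeasure μ] [IsProbabilityMeasure μ'] [NormedAddCommGroup E]
    [MeasurableSpace E] [BorelSpace E] {T : ℕ → Ω → E}
    (hT : TendstoInDistribution T atTop (fun _ : Ω' => (0 : E)) (fun _ => μ) μ') :
    TendstoInMeasure μ T atTop fun _ => 0 := by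
  rw [tendstoInMeasure_iff_norm]
  intro ε hε
  have hmap : μ'.map (fun _ : Ω' => (0 : E)) = Measure.dirac 0 := by simp
  have hcl : IsClosed {x : E | ε ≤ ‖x‖} := isClosed_le continuous_const continuous_norm
  have hz : μ'.map (fun _ : Ω' => (0 : E)) {x : E | ε ≤ ‖x‖} = 0 := by
    rw [hmap, Measure.dirac_apply' _ hcl.measurableSet]
    simp [hε]
  -- Portmanteau: the frontier of this closed set lies inside it, hence is null for the point mass
  -- at `0`.
  have key := ProbabilityMeasure.tendsto_measure_of_null_frontier_of_tendsto' hT.tendsto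
    (E := {x : E | ε ≤ ‖x‖}) (measure_mono_null hcl.frontier_subset hz)
  simp only [ProbabilityMeasure.coe_mk] at key
  rw [hz] at key
  refine key.congr fun n => ?_
  rw [Measure.map_apply_of_aemeasurable (hT.forall_aemeasurable n) hcl.measurableSet]
  simp

/-! ### Multivariate central limit theorem -/

section CentralLimit

variable {Ω : Type*} [MeasurableSpace Ω] {p : ℕ} {μ : Measure Ω} [IsProbabilityMeasure μ]
  {S : Matrix (Fin p) (Fin p) ℝ}

omit [IsProbabilityMeasure μ] in
lemma MeasureTheory.MemLp.euclideanSpace_apply {V : Ω → EuclideanSpace ℝ (Fin p)}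
    (h : MemLp V 2 μ) (i : Fin p) : MemLp (fun ω => V ω i) 2 μ :=
  (EuclideanSpace.proj (𝕜 := ℝ) i).comp_memLp' h

/-- The variance of a linear form of a vector with a given covariance matrix. -/
lemma HasCovMatrix.variance_inner {V : Ω → EuclideanSpace ℝ (Fin p)} (h : HasCovMatrix V S μ)
    (t : EuclideanSpace ℝ (Fin p)) :
    Var[fun ω => inner ℝ t (V ω); μ] = t ⬝ᵥ S *ᵥ t := by
  have hin : (fun ω => inner ℝ t (V ω)) = fun ω => ∑ i, t i * V ω i := by
    ext ω
    simp [PiLp.inner_apply, mul_comm]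
  have hm (i : Fin p) : MemLp (fun ω => t i * V ω i) 2 μ :=
    (h.1.euclideanSpace_apply i).const_mul (t i)
  rw [hin, variance_fun_sum hm]
  simp only [dotProduct, Matrix.mulVec, Finset.mul_sum]
  refine Finset.sum_congr rfl fun i _ => Finset.sum_congr rfl fun j _ => ?_
  rw [covariance_const_mul_left, covariance_const_mul_right, h.2]
  ring

-- Cramér–Wold in Fourier form: reduces convergence of random vectors to the real central limit
-- theorem along each direction `t`.
omit [IsProbabilityMeasure μ] in
lemma charFun_map_inner_one {Z : Ω → EuclideanSpace ℝ (Fin p)} (hZ : AEMeasurable Z μ)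
    (t : EuclideanSpace ℝ (Fin p)) :
    charFun (μ.map fun ω => inner ℝ t (Z ω)) 1 = charFun (μ.map Z) t := by
  have hmeas : Measurable fun v : EuclideanSpace ℝ (Fin p) => inner ℝ t v := by fun_prop
  rw [charFun_apply, charFun_apply,
    integral_map (φ := fun ω => inner ℝ t (Z ω)) (hmeas.comp_aemeasurable hZ) (by fun_prop),
    integral_map hZ (by fun_prop)]
  simp [real_inner_comm]

/-- Multivariate central limit theorem for centred vectors. -/
theorem tendstoInDistribution_inv_sqrt_smul_sum {Ω' : Type*} [MeasurableSpace Ω']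
    {μ' : Measure Ω'} [IsProbabilityMeasure μ'] {W : Ω' → EuclideanSpace ℝ (Fin p)}
    (hS : S.PosSemidef) (hW : HasLaw W (multivariateGaussian 0 S) μ')
    {V : ℕ → Ω → EuclideanSpace ℝ (Fin p)} (hV : HasCovMatrix (V 0) S μ) (h0 : μ[V 0] = 0)
    (hindep : iIndepFun V μ) (hident : ∀ n, IdentDistrib (V n) (V 0) μ μ) :
    TendstoInDistribution (fun (N : ℕ) ω => (√N)⁻¹ • ∑ k ∈ Finset.range N, V k ω) atTop W
      (fun _ => μ) μ' where
  forall_aemeasurable N :=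
    .fun_const_smul (Finset.aemeasurable_fun_sum _ fun k _ => (hident k).aemeasurable_fst) _
  aemeasurable_limit := hW.aemeasurable
  tendsto := by
    refine ProbabilityMeasure.tendsto_iff_tendsto_charFun.2 fun t => ?_
    have hcont : Continuous fun v : EuclideanSpace ℝ (Fin p) => inner ℝ t v := by fun_prop
    have hmeas : Measurable fun v : EuclideanSpace ℝ (Fin p) => inner ℝ t v := hcont.measurable
    have hmean : ∫ ω, inner ℝ t (V 0 ω) ∂μ = 0 := by
      rw [integral_inner (hV.1.integrable (by norm_num)), h0, inner_zero_right]
    have hvar := hV.variance_inner t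
    have hlaw : HasLaw (fun ω' => inner ℝ t (W ω'))
        (gaussianReal 0 Var[fun ω => inner ℝ t (V 0 ω); μ].toNNReal) μ' := by
      refine ⟨hmeas.comp_aemeasurable hW.aemeasurable, ?_⟩
      change μ'.map ((fun v => inner ℝ t v) ∘ W) = _
      rw [← AEMeasurable.map_map_of_aemeasurable hmeas.aemeasurable hW.aemeasurable, hW.map_eq]
      have := IsGaussian.map_eq_gaussianReal (μ := multivariateGaussian 0 S) (innerSL ℝ t)
      have hm : ∫ x, innerSL ℝ t x ∂(multivariateGaussian 0 S) = 0 := by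
        rw [ContinuousLinearMap.integral_comp_comm _ IsGaussian.integrable_fun_id]
        simp
      have hc : HasCovMatrix (fun x => x) S (multivariateGaussian 0 S) :=
        ⟨IsGaussian.memLp_two_id, fun i j => covariance_eval_multivariateGaussian hS i j⟩
      have hv : Var[innerSL ℝ t; multivariateGaussian 0 S] =
          Var[fun ω => inner ℝ t (V 0 ω); μ] := by
        rw [hvar]
        exact hc.variance_inner t
      rw [hm, hv] at this
      exact this
    have hclt := tendstoInDistribution_inv_sqrt_mul_sum_sub (P := μ) (P' := μ')
      (X := fun n ω => inner ℝ t (V n ω)) hlaw (hV.1.const_inner t)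
      (hindep.comp (fun _ v => inner ℝ t v) fun _ => hmeas) fun n => (hident n).comp hmeas
    have hchar := ProbabilityMeasure.tendsto_iff_tendsto_charFun.1 hclt.tendsto 1
    simp only [ProbabilityMeasure.coe_mk] at hchar ⊢
    rw [charFun_map_inner_one hW.aemeasurable] at hchar
    refine hchar.congr fun N => ?_
    rw [← charFun_map_inner_one (AEMeasurable.fun_const_smul (Finset.aemeasurable_fun_sum _
      fun k _ => (hident k).aemeasurable_fst) _)]
    simp [hmean, inner_smul_right, inner_sum]

/-- Multiplying a centred vector by an independent standardized scalar preserves the mean and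
the covariance matrix. -/
lemma HasCovMatrix.smul_of_indepFun {U : Ω → ℝ} {Z : Ω → EuclideanSpace ℝ (Fin p)}
    (hZ : HasCovMatrix Z S μ) (hZ0 : μ[Z] = 0) (hU : MemLp U 2 μ) (hU0 : μ[U] = 0)
    (hU1 : ∫ ω, U ω ^ 2 ∂μ = 1) (hind : IndepFun U Z μ) :
    HasCovMatrix (fun ω => U ω • Z ω) S μ ∧ ∫ ω, U ω • Z ω ∂μ = 0 := by
  have hmean : ∫ ω, U ω • Z ω ∂μ = 0 := by
    rw [hind.integral_fun_smul_eq_smul_integral hU.1 hZ.1.1, hU0, zero_smul]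
  have hmem : MemLp (fun ω => U ω • Z ω) 2 μ := by
    refine (memLp_two_iff_integrable_sq_norm (hU.1.smul hZ.1.1)).2 ?_
    -- Independence makes the product of the squared norms integrable, so second moments of `U` and
    -- `Z` suffice.
    have h2 : Integrable ((fun ω => ‖U ω‖ ^ 2) * fun ω => ‖Z ω‖ ^ 2) μ :=
      (hind.comp (φ := fun u : ℝ => ‖u‖ ^ 2)
        (ψ := fun z : EuclideanSpace ℝ (Fin p) => ‖z‖ ^ 2)
        (by fun_prop) (by fun_prop)).integrable_mul
        ((memLp_two_iff_integrable_sq_norm hU.1).1 hU)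
        ((memLp_two_iff_integrable_sq_norm hZ.1.1).1 hZ.1)
    refine h2.congr (ae_of_all _ fun ω => ?_)
    simp [norm_smul, mul_pow]
  refine ⟨⟨hmem, fun i j => ?_⟩, hmean⟩
  have hcoord (i : Fin p) : ∫ ω, Z ω i ∂μ = 0 := by
    have := (EuclideanSpace.proj (𝕜 := ℝ) i).integral_comp_comm (hZ.1.integrable (by norm_num))
    rw [hZ0] at this
    simpa using this
  have hcoord' (i : Fin p) : ∫ ω, U ω * Z ω i ∂μ = 0 := by
    have := (EuclideanSpace.proj (𝕜 := ℝ) i).integral_comp_comm (hmem.integrable (by norm_num))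
    rw [hmean] at this
    simpa using this
  have hcov := hZ.2 i j
  rw [covariance_eq_sub (hZ.1.euclideanSpace_apply i) (hZ.1.euclideanSpace_apply j), hcoord,
    zero_mul, sub_zero] at hcov
  rw [covariance_eq_sub (hmem.euclideanSpace_apply i) (hmem.euclideanSpace_apply j)]
  simp only [PiLp.smul_apply, smul_eq_mul, Pi.mul_apply, hcoord', zero_mul, sub_zero] at hcov ⊢
  -- All means vanish, so the covariance is `E[U² Zᵢ Zⱼ] = E[U²] E[Zᵢ Zⱼ]`, with `E[U²] = 1`.
  have hprod := (hind.comp (φ := fun u : ℝ => u ^ 2)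
    (ψ := fun z : EuclideanSpace ℝ (Fin p) => z i * z j)
    (by fun_prop) (by fun_prop)).integral_fun_mul_eq_mul_integral
    (hU.1.aemeasurable.pow_const 2).aestronglyMeasurable ((hZ.1.euclideanSpace_apply i).1.mul (hZ.1.euclideanSpace_apply j).1)
  simp only [Function.comp_apply, hU1, one_mul, hcov] at hprod
  rw [← hprod]
  congr with ω
  ring

end CentralLimit

/-! ### Algebra of the statistic -/

/-- The centred cross-product statistic in terms of standardized observations. -/
lemma toLp_transpose_designMatrix_mulVec {Ω : Type*} {p : ℕ}
    {X : ℕ → Ω → EuclideanSpace ℝ (Fin p)} {Y : ℕ → Ω → ℝ} {c : EuclideanSpace ℝ (Fin p)}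
    {m s : ℝ} {Z : ℕ → Ω → EuclideanSpace ℝ (Fin p)} {U : ℕ → Ω → ℝ} {ω : Ω}
    (hX : ∀ n, X n ω = c + Z n ω) (hY : ∀ n, Y n ω = m + s * U n ω) {N : ℕ} (hN : N ≠ 0) :
    WithLp.toLp 2 ((designMatrix X N ω)ᵀ *ᵥ
      (responseVector Y N ω - vectorMean (responseVector Y N ω) • (1 : Fin N → ℝ))) =
    (√N * s) • ((√N)⁻¹ • ∑ k ∈ Finset.range N, U k ω • Z k ω -
      ((∑ k ∈ Finset.range N, U k ω) / N) • (√N)⁻¹ • ∑ k ∈ Finset.range N, Z k ω) := by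
  have hN' : (N : ℝ) ≠ 0 := Nat.cast_ne_zero.2 hN
  have hs : √(N : ℝ) ≠ 0 := (Real.sqrt_pos.2 (by positivity)).ne'
  have hmean : vectorMean (responseVector Y N ω) =
      m + s * ((∑ k ∈ Finset.range N, U k ω) / N) := by
    rw [vectorMean, show (∑ n, responseVector Y N ω n) = ∑ k ∈ Finset.range N, Y k ω from
      Fin.sum_univ_eq_sum_range (fun n => Y n ω) N]
    simp only [hY, Finset.sum_add_distrib, ← Finset.mul_sum]
    simp
    field_simp
  rw [smul_comm _ (√(N : ℝ))⁻¹, ← smul_sub, smul_smul,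
    show √(N : ℝ) * s * (√(N : ℝ))⁻¹ = s by field_simp, hmean]
  set u := (∑ k ∈ Finset.range N, U k ω) / N with hu
  -- Deviations from the sample mean sum to zero; this cancels the shift `c` of the covariates.
  have hsum : ∑ k ∈ Finset.range N, (U k ω - u) = 0 := by
    rw [Finset.sum_sub_distrib, hu]
    simp
    field_simp
    simp
  ext j
  have hL : ((designMatrix X N ω)ᵀ *ᵥ
      (responseVector Y N ω - (m + s * u) • (1 : Fin N → ℝ))) j =
      ∑ k ∈ Finset.range N, X k ω j * (Y k ω - (m + s * u)) := by
    rw [← Fin.sum_univ_eq_sum_range (fun k => X k ω j * (Y k ω - (m + s * u)))]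
    simp [Matrix.mulVec, dotProduct, designMatrix, responseVector]
  have hR : ∑ k ∈ Finset.range N, X k ω j * (Y k ω - (m + s * u)) =
      s * (c j * ∑ k ∈ Finset.range N, (U k ω - u) +
        ∑ k ∈ Finset.range N, (U k ω * Z k ω j - u * Z k ω j)) := by
    rw [Finset.mul_sum, ← Finset.sum_add_distrib, Finset.mul_sum]
    refine Finset.sum_congr rfl fun k _ => ?_
    rw [hX, hY]
    simp only [PiLp.add_apply]
    ring
  rw [hsum, mul_zero, zero_add, Finset.sum_sub_distrib, ← Finset.mul_sum] at hR
  simp only [hL, hR, PiLp.smul_apply, PiLp.sub_apply, WithLp.ofLp_sum, Finset.sum_apply,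
    smul_eq_mul]

/-- The factor `√N` cancels, leaving a form to which Slutsky's theorem applies: a norm of normalized
sums times a ratio of scales. -/
lemma glmStatistic_eq {Ω : Type*} {p : ℕ} (nrm : Seminorm ℝ (EuclideanSpace ℝ (Fin p)))
    {X : ℕ → Ω → EuclideanSpace ℝ (Fin p)} {Y xiHat : ℕ → Ω → ℝ}
    {c : EuclideanSpace ℝ (Fin p)} {m s : ℝ} (hs : 0 ≤ s)
    {Z : ℕ → Ω → EuclideanSpace ℝ (Fin p)} {U : ℕ → Ω → ℝ} {ω : Ω}
    (hX : ∀ n, X n ω = c + Z n ω) (hY : ∀ n, Y n ω = m + s * U n ω) (N : ℕ) :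
    glmStatistic nrm X Y xiHat N ω =
      nrm ((√N)⁻¹ • ∑ k ∈ Finset.range N, U k ω • Z k ω -
        ((∑ k ∈ Finset.range N, U k ω) / N) • (√N)⁻¹ • ∑ k ∈ Finset.range N, Z k ω) *
        (s * (√(xiHat N ω))⁻¹) := by
  -- At `N = 0` both sides are `0`: a division by `√0` on the left, empty sums on the right.
  rcases eq_or_ne N 0 with rfl | hN
  · simp [glmStatistic]
  have hsN : √(N : ℝ) ≠ 0 :=
    (Real.sqrt_pos.2 (Nat.cast_pos.2 (Nat.pos_of_ne_zero hN))).ne'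
  rw [glmStatistic, toLp_transpose_designMatrix_mulVec hX hY hN, map_smul_eq_mul,
    Real.sqrt_mul (Nat.cast_nonneg N), Real.norm_eq_abs,
    abs_of_nonneg (mul_nonneg (Real.sqrt_nonneg _) hs), div_eq_mul_inv, mul_inv]
  field_simp

/-! ### Slutsky argument for the statistic -/

section Convergence

variable {Ω : Type*} [MeasurableSpace Ω] {p : ℕ} {μ : Measure Ω} [IsProbabilityMeasure μ]
  {S : Matrix (Fin p) (Fin p) ℝ}

lemma HasCovMatrix.sub_mean {V : Ω → EuclideanSpace ℝ (Fin p)} (h : HasCovMatrix V S μ) :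
    HasCovMatrix (fun ω => V ω - μ[V]) S μ := by
  refine ⟨h.1.sub (memLp_const _), fun i j => ?_⟩
  have hi (i : Fin p) : Integrable (fun ω => V ω i) μ :=
    (h.1.euclideanSpace_apply i).integrable (by norm_num)
  simp only [PiLp.sub_apply]
  rw [covariance_sub_const_left (hi i), covariance_sub_const_right (hi j), h.2]

/-- The statistic converges in distribution if covariates and responses are independent i.i.d.
sequences with finite second moments. -/
theorem tendstoInDistribution_glmStatistic {Ω' : Type*} [MeasurableSpace Ω'] {μ' : Measure Ω'}
    [IsProbabilityMeasure μ'] {W : Ω' → EuclideanSpace ℝ (Fin p)}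
    (nrm : Seminorm ℝ (EuclideanSpace ℝ (Fin p))) (hS : S.PosSemidef)
    (hW : HasLaw W (multivariateGaussian 0 S) μ')
    {X : ℕ → Ω → EuclideanSpace ℝ (Fin p)} {Y xiHat : ℕ → Ω → ℝ} {ξ : ℝ}
    (hindep : iIndepFun (fun n ω => (X n ω, Y n ω)) μ)
    (hXident : ∀ n, IdentDistrib (X n) (X 0) μ μ)
    (hYident : ∀ n, IdentDistrib (Y n) (Y 0) μ μ)
    (hXY : ∀ n, IndepFun (X n) (Y n) μ) (hX : HasCovMatrix (X 0) S μ) (hY : MemLp (Y 0) 2 μ)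
    (hvar : Var[Y 0; μ] = ξ) (hξ : 0 < ξ) (hmeas : ∀ N, AEMeasurable (xiHat N) μ)
    (hxi : TendstoInMeasure μ xiHat atTop fun _ => ξ) :
    TendstoInDistribution (glmStatistic nrm X Y xiHat) atTop (fun ω' => nrm (W ω'))
      (fun _ => μ) μ' := by
  set c := μ[X 0] with hc
  set m := μ[Y 0] with hm
  have hsξ : √ξ ≠ 0 := (Real.sqrt_pos.2 hξ).ne'
  let Z : ℕ → Ω → EuclideanSpace ℝ (Fin p) := fun n ω => X n ω - c
  let U : ℕ → Ω → ℝ := fun n ω => (Y n ω - m) / √ξ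
  have hfZ : Measurable fun x : EuclideanSpace ℝ (Fin p) => x - c := by fun_prop
  have hfU : Measurable fun y : ℝ => (y - m) / √ξ := by fun_prop
  have hZident (n) : IdentDistrib (Z n) (Z 0) μ μ := (hXident n).comp hfZ
  have hUident (n) : IdentDistrib (U n) (U 0) μ μ := (hYident n).comp hfU
  have hZUind (n) : IndepFun (U n) (Z n) μ := (hXY n).symm.comp hfU hfZ
  -- Independence within each pair makes its law the product of the marginals, which do not depend
  -- on `n`.
  have hpair (n) : IdentDistrib (fun ω => (U n ω, Z n ω)) (fun ω => (U 0 ω, Z 0 ω)) μ μ :=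
    (hUident n).prodMk (hZident n) (hZUind n) (hZUind 0)
  have hZcov : HasCovMatrix (Z 0) S μ := hX.sub_mean
  have hZ0 : μ[Z 0] = 0 := by
    simp only [Z]
    rw [integral_sub (hX.1.integrable (by norm_num)) (integrable_const _)]
    simp [hc]
  have hU0 : μ[U 0] = 0 := by
    simp only [U]
    rw [integral_div, integral_sub (hY.integrable (by norm_num)) (integrable_const _)]
    simp [hm]
  have hU1 : ∫ ω, U 0 ω ^ 2 ∂μ = 1 := by
    simp only [U, div_pow, Real.sq_sqrt hξ.le]
    rw [integral_div, ← variance_eq_integral hY.1.aemeasurable, hvar, div_self hξ.ne']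
  have hU2 : MemLp (U 0) 2 μ := by
    simpa only [U, div_eq_mul_inv, Pi.sub_apply] using (hY.sub (memLp_const m)).mul_const (√ξ)⁻¹
  obtain ⟨hVcov, hV0⟩ := hZcov.smul_of_indepFun hZ0 hU2 hU0 hU1 (hZUind 0)
  have hA := tendstoInDistribution_inv_sqrt_smul_sum hS hW (V := fun n ω => U n ω • Z n ω)
    hVcov hV0
    (hindep.comp (fun _ z => ((z.2 - m) / √ξ) • (z.1 - c)) fun _ => by fun_prop)
    fun n => (hpair n).comp (u := fun z : ℝ × EuclideanSpace ℝ (Fin p) => z.1 • z.2) (by fun_prop)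
  have hC := tendstoInDistribution_inv_sqrt_smul_sum hS hW hZcov hZ0
    (hindep.comp (fun _ z => z.1 - c) fun _ => by fun_prop) hZident
  have hUind : iIndepFun U μ :=
    hindep.comp (fun _ z => (z.2 - m) / √ξ) fun _ => by fun_prop
  have hUbar_meas (N : ℕ) : AEMeasurable (fun ω => (∑ k ∈ Finset.range N, U k ω) / N) μ :=
    (Finset.aemeasurable_fun_sum _ fun k _ => (hUident k).aemeasurable_fst).div_const _
  have hUbar : TendstoInMeasure μ (fun (N : ℕ) ω => (∑ k ∈ Finset.range N, U k ω) / N) atTop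
      fun _ => 0 := by
    refine tendstoInMeasure_of_tendsto_ae (fun N => (hUbar_meas N).aestronglyMeasurable) ?_
    rw [← hU0]
    exact strong_law_ae_real U (hU2.integrable (by norm_num))
      (fun i j hij => hUind.indepFun hij) hUident
  -- The normalized sum of the `Z k` converges in law and `Ū → 0` in probability, so the product
  -- tends to `0`.
  have hB := (hC.continuous_comp_prodMk_of_tendstoInMeasure_const
    (g := fun z : EuclideanSpace ℝ (Fin p) × ℝ => -(z.2 • z.1)) (by fun_prop)
    hUbar hUbar_meas)
  simp only [zero_smul, neg_zero] at hB
  have hD := hA.add_of_tendstoInMeasure_const hB.tendstoInMeasure_zero hB.forall_aemeasurable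
  have hr : TendstoInMeasure μ (fun N ω => √ξ * (√(xiHat N ω))⁻¹) atTop fun _ => 1 := by
    have hcont : ContinuousAt (fun x => √ξ * (√x)⁻¹) ξ :=
      continuousAt_const.mul (Real.continuous_sqrt.continuousAt.inv₀ hsξ)
    simpa [hsξ] using hxi.comp_continuousAt_const hcont
  have hnrm := nrm.continuous_euclideanSpace
  have hT := hD.continuous_comp_prodMk_of_tendstoInMeasure_const
    (g := fun z : EuclideanSpace ℝ (Fin p) × ℝ => nrm z.1 * z.2) (by fun_prop) hr
    fun N => by have := hmeas N; fun_prop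
  refine hT.congr (fun N => ae_of_all _ fun ω => ?_) (ae_of_all _ fun ω' => by simp)
  rw [glmStatistic_eq nrm (Real.sqrt_nonneg ξ) (c := c) (m := m) (Z := Z) (U := U)
    (fun n => by simp [Z]) fun n => by simp only [U]; field_simp; ring]
  simp [sub_eq_add_neg]

end Convergence

/-! ### Exponential families: the mean determines the law -/

namespace ExpFamily

variable (F : ExpFamily)

lemma measurable_density (θ φ : ℝ) : Measurable (F.density θ φ) := by
  have := F.measurable_c φ
  unfold density
  fun_prop

lemma measurable_density_prod {α : Type*} [MeasurableSpace α] {θ : α → ℝ} (hθ : Measurable θ)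
    (φ : ℝ) : Measurable fun z : α × ℝ => F.density (θ z.1) φ z.2 := by
  have h1 := (F.measurable_c φ).comp (measurable_snd : Measurable (Prod.snd : α × ℝ → ℝ))
  have h2 := F.measurable_b.comp (hθ.comp (measurable_fst : Measurable (Prod.fst : α × ℝ → α)))
  have h3 := hθ.comp (measurable_fst : Measurable (Prod.fst : α × ℝ → α))
  simp only [Function.comp_def] at h1 h2 h3
  unfold density
  fun_prop

/-- Two members of the family with the same dispersion differ by an exponential tilt. -/
lemma law_eq_withDensity (θ θ' φ : ℝ) :
    F.law θ' φ = (F.law θ φ).withDensity fun y =>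
      ENNReal.ofReal (Real.exp ((y * (θ' - θ) - (F.b θ' - F.b θ)) / F.a φ)) := by
  rw [law, law, ← withDensity_mul _ (F.measurable_density θ φ).ennreal_ofReal (by fun_prop)]
  congr with y
  rw [Pi.mul_apply, density, density, ← ENNReal.ofReal_mul (Real.exp_pos _).le, ← Real.exp_add]
  congr 2
  ring

/-- In an exponential family with fixed dispersion, the mean determines the distribution. -/
theorem law_eq_of_integral_eq {θ θ' φ : ℝ} [IsProbabilityMeasure (F.law θ φ)]
    [IsProbabilityMeasure (F.law θ' φ)] (hint : Integrable (fun y => y) (F.law θ φ))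
    (hint' : Integrable (fun y => y) (F.law θ' φ))
    (hmean : ∫ y, y ∂(F.law θ φ) = ∫ y, y ∂(F.law θ' φ)) : F.law θ φ = F.law θ' φ := by
  set ν := F.law θ φ with hν
  set m := ∫ y, y ∂ν with hm
  set k := (θ' - θ) / F.a φ with hk
  let r : ℝ → ℝ := fun y => Real.exp (y * k - (F.b θ' - F.b θ) / F.a φ)
  have hr : Measurable r := by fun_prop
  have htilt : F.law θ' φ = ν.withDensity fun y => ENNReal.ofReal (r y) := by
    rw [F.law_eq_withDensity θ θ' φ]
    congr with y
    congr 2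
    rw [hk]
    ring
  have hcentred' : Integrable (fun y => y - m) (F.law θ' φ) := hint'.sub (integrable_const m)
  have hI0 : ∫ y, (y - m) ∂ν = 0 := by
    rw [integral_sub hint (integrable_const m)]
    simp [hm]
  have hI1 : ∫ y, (y - m) ∂(F.law θ' φ) = 0 := by
    rw [integral_sub hint' (integrable_const m), ← hmean]
    simp
  rw [htilt, integrable_withDensity_iff hr.ennreal_ofReal (by simp)] at hcentred'
  rw [htilt, integral_withDensity_eq_integral_toReal_smul hr.ennreal_ofReal (by simp)] at hI1
  have hrpos (y : ℝ) : 0 < r y := Real.exp_pos _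
  simp only [ENNReal.toReal_ofReal (hrpos _).le, smul_eq_mul] at hcentred' hI1
  have hcen : Integrable (fun y => (y - m) * r m) ν :=
    (hint.sub (integrable_const m)).mul_const _
  have hprodint : Integrable (fun y => (y - m) * (r y - r m)) ν := by
    simp only [mul_sub]
    exact hcentred'.sub hcen
  -- Both laws have mean `m`, so `y - m` integrates to zero against `ν` and against `r ν`.
  have hzero : ∫ y, (y - m) * (r y - r m) ∂ν = 0 := by
    simp only [mul_sub]
    rw [integral_sub hcentred' hcen, integral_mul_const, hI0]
    simpa [mul_comm] using hI1
  -- The likelihood ratio `r` is monotone, in the direction given by the sign of `k`; the integrand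
  -- has constant sign and zero integral.
  have hae : ∀ᵐ y ∂ν, (y - m) * (r y - r m) = 0 := by
    rcases le_total 0 k with h | h
    · refine (integral_eq_zero_iff_of_nonneg (fun y => ?_) hprodint).1 hzero
      rcases le_total m y with hy | hy
      · exact mul_nonneg (sub_nonneg.2 hy) (sub_nonneg.2 (Real.exp_le_exp.2 (by gcongr)))
      · exact mul_nonneg_of_nonpos_of_nonpos (sub_nonpos.2 hy)
          (sub_nonpos.2 (Real.exp_le_exp.2 (by gcongr)))
    · have hneg : ∫ y, -((y - m) * (r y - r m)) ∂ν = 0 := by rw [integral_neg, hzero, neg_zero]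
      have := (integral_eq_zero_iff_of_nonneg (fun y => ?_) hprodint.neg).1 hneg
      · filter_upwards [this] with y hy
        simpa using hy
      refine neg_nonneg.2 ?_
      rcases le_total m y with hy | hy
      · exact mul_nonpos_of_nonneg_of_nonpos (sub_nonneg.2 hy)
          (sub_nonpos.2 (Real.exp_le_exp.2 (sub_le_sub_right
            (mul_le_mul_of_nonpos_right hy h) _)))
      · exact mul_nonpos_of_nonpos_of_nonneg (sub_nonpos.2 hy)
          (sub_nonneg.2 (Real.exp_le_exp.2 (sub_le_sub_right
            (mul_le_mul_of_nonpos_right hy h) _)))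
  have hconst : (fun y => ENNReal.ofReal (r y)) =ᵐ[ν] fun _ => ENNReal.ofReal (r m) := by
    filter_upwards [hae] with y hy
    rcases mul_eq_zero.1 hy with h | h
    · rw [sub_eq_zero.1 h]
    · rw [sub_eq_zero.1 h]
  rw [withDensity_congr_ae hconst, withDensity_const] at htilt
  -- The ratio is a.e. constant, and equal total masses force the constant to be `1`.
  have hone : ENNReal.ofReal (r m) = 1 := by
    have := congrArg (fun ρ : Measure ℝ => ρ Set.univ) htilt
    simpa using this.symm
  rw [htilt, hone, one_smul]

/-- Rectangles under a joint law with conditional densities in the family. -/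
lemma withDensity_prod_apply {α : Type*} [MeasurableSpace α] {ν : Measure α} [SFinite ν]
    {θ : α → ℝ} (hθ : Measurable θ) (φ : ℝ) {s : Set α} {t : Set ℝ} (hs : MeasurableSet s)
    (ht : MeasurableSet t) :
    ((ν.prod F.base).withDensity fun z => ENNReal.ofReal (F.density (θ z.1) φ z.2)) (s ×ˢ t) =
      ∫⁻ x in s, F.law (θ x) φ t ∂ν := by
  have := F.sigmaFinite_base
  rw [withDensity_apply _ (hs.prod ht), ← Measure.prod_restrict,
    lintegral_prod _ (F.measurable_density_prod hθ φ).ennreal_ofReal.aemeasurable]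
  simp only [law, withDensity_apply _ ht]

lemma measurable_law_apply {α : Type*} [MeasurableSpace α] {θ : α → ℝ} (hθ : Measurable θ)
    (φ : ℝ) {t : Set ℝ} (ht : MeasurableSet t) : Measurable fun x => F.law (θ x) φ t := by
  have := F.sigmaFinite_base
  simp only [law, withDensity_apply _ ht]
  exact (F.measurable_density_prod hθ φ).ennreal_ofReal.lintegral_prod_right'

end ExpFamily

/-! ### Reduction of the null model to an i.i.d. sample -/

/-- Under the null hypothesis, the data of a generalized linear model form an i.i.d. sample of
one member of the exponential family, independent of the covariates. -/
theorem IsGLM.exists_isIIDExpSample {Ω : Type*} [MeasurableSpace Ω] {p : ℕ} {F : ExpFamily}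
    {g : PartialEquiv ℝ ℝ} {X : ℕ → Ω → EuclideanSpace ℝ (Fin p)} {Y : ℕ → Ω → ℝ}
    {π : GLMParam p} {μ : Measure Ω} [IsProbabilityMeasure μ] (h : IsGLM F g X Y π μ)
    (hπ : π.slope = 0) : ∃ θ, IsIIDExpSample F θ π.dispersion X Y μ := by
  have hXm (n) : AEMeasurable (X n) μ := (h.ident_covariates n).aemeasurable_fst
  have hprob (n) : IsProbabilityMeasure (μ.map (X n)) := Measure.isProbabilityMeasure_map (hXm n)
  choose θ hθ hjoint hmean using h.conditional_response
  simp only [hπ, inner_zero_right, add_zero] at hmean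
  have hrect (n) {s : Set (EuclideanSpace ℝ (Fin p))} {t : Set ℝ} (hs : MeasurableSet s)
      (ht : MeasurableSet t) : μ.map (fun ω => (X n ω, Y n ω)) (s ×ˢ t) =
        ∫⁻ x in s, F.law (θ n x) π.dispersion t ∂(μ.map (X n)) := by
    rw [hjoint n, F.withDensity_prod_apply (hθ n) _ hs ht]
  -- Normalization of the conditional laws is recovered from the joint law: the mass of `s ×ˢ univ`
  -- is that of `s` under the covariate law.
  have huniv (n) : ∀ᵐ x ∂(μ.map (X n)), F.law (θ n x) π.dispersion Set.univ = 1 := by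
    refine ae_eq_of_forall_setLIntegral_eq_of_sigmaFinite
      (F.measurable_law_apply (hθ n) _ .univ) measurable_const fun s hs _ => ?_
    rw [← hrect n hs .univ, Measure.map_apply_of_aemeasurable
      ((hXm n).prodMk (h.aemeasurable_response n)) (hs.prod .univ)]
    simp [Measure.map_apply_of_aemeasurable (hXm n) hs, Set.mk_preimage_prod]
  -- Any typical covariate value serves as reference; `θ 0 x₀` becomes the common parameter. The
  -- functions `θ n` may differ from it, but their laws share its mean and so coincide with its law
  -- almost everywhere.
  obtain ⟨x₀, hx₀, hx₀', -, hx₀''⟩ := ((huniv 0).and (hmean 0)).exists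
  have hP₀ : IsProbabilityMeasure (F.law (θ 0 x₀) π.dispersion) := ⟨hx₀⟩
  have hlaw (n) : ∀ᵐ x ∂(μ.map (X n)),
      F.law (θ n x) π.dispersion = F.law (θ 0 x₀) π.dispersion := by
    filter_upwards [huniv n, hmean n] with x hx hx'
    have : IsProbabilityMeasure (F.law (θ n x) π.dispersion) := ⟨hx⟩
    exact F.law_eq_of_integral_eq hx'.1 hx₀' (hx'.2.2.trans hx₀''.symm)
  have hprod (n) : μ.map (fun ω => (X n ω, Y n ω)) =
      (μ.map (X n)).prod (F.law (θ 0 x₀) π.dispersion) := by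
    refine (Measure.prod_eq fun s t hs ht => ?_).symm
    rw [hrect n hs ht, setLIntegral_congr_fun_ae (g := fun _ => F.law (θ 0 x₀) π.dispersion t) hs
      (by filter_upwards [hlaw n] with x hx _ using by rw [hx])]
    simp [mul_comm]
  have hYlaw (n) : μ.map (Y n) = F.law (θ 0 x₀) π.dispersion := by
    have := congrArg Measure.snd (hprod n)
    rwa [Measure.snd_map_prodMk₀ (hXm n), Measure.snd_prod] at this
  refine ⟨θ 0 x₀, h.indep, h.ident_covariates, fun n => ?_, fun n =>
    ⟨h.aemeasurable_response n, hYlaw n⟩⟩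
  rw [indepFun_iff_map_prod_eq_prod_map_map (hXm n) (h.aemeasurable_response n), hprod n, hYlaw n]

lemma IsIIDExpSample.identDistrib_response {Ω : Type*} [MeasurableSpace Ω] {p : ℕ}
    {F : ExpFamily} {θ φ : ℝ} {X : ℕ → Ω → EuclideanSpace ℝ (Fin p)} {Y : ℕ → Ω → ℝ}
    {μ : Measure Ω} (h : IsIIDExpSample F θ φ X Y μ) (n : ℕ) :
    IdentDistrib (Y n) (Y 0) μ μ :=
  ⟨(h.law_response n).aemeasurable, (h.law_response 0).aemeasurable,
    (h.law_response n).map_eq.trans (h.law_response 0).map_eq.symm⟩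

/-! ### Main theorem -/

theorem theorem1 {p : ℕ}
    -- an arbitrary norm on `ℝᵖ`
    (nrm : Seminorm ℝ (EuclideanSpace ℝ (Fin p))) (hnrm : ∀ v, nrm v = 0 → v = 0)
    (S : Matrix (Fin p) (Fin p) ℝ) (hS : S.PosDef)
    (F : ExpFamily)
    {Ω : Type*} [MeasurableSpace Ω]
    (X : ℕ → Ω → EuclideanSpace ℝ (Fin p)) (Y : ℕ → Ω → ℝ) (xiHat : ℕ → Ω → ℝ)
    {Ω' : Type*} [MeasurableSpace Ω'] (μ' : Measure Ω') [IsProbabilityMeasure μ']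
    (W : Ω' → EuclideanSpace ℝ (Fin p)) (hW : HasLaw W (multivariateGaussian 0 S) μ') :
    -- convergence in distribution of the statistic for i.i.d. responses
    (∀ (μ : Measure Ω) [IsProbabilityMeasure μ] (θ φ ξ : ℝ),
      IsIIDExpSample F θ φ X Y μ →
      HasCovMatrix (X 0) S μ →
      MemLp (Y 0) 2 μ → Var[Y 0; μ] = ξ → 0 < ξ →
      (∀ N, AEMeasurable (xiHat N) μ) →
      TendstoInMeasure μ xiHat atTop (fun _ => ξ) →
      TendstoInDistribution (glmStatistic nrm X Y xiHat) atTop (fun ω' => nrm (W ω'))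
        (fun _ => μ) μ') ∧
    -- asymptotic pivotality in the generalized linear model under the null hypothesis `β = 0`
    (∀ (g : PartialEquiv ℝ ℝ) (Θ : Set (GLMParam p)) (Pr : GLMParam p → ProbabilityMeasure Ω),
      (∀ π ∈ Θ, IsGLM F g X Y π (Pr π : Measure Ω)) →
      (∀ π ∈ nullHypothesis Θ,
        HasCovMatrix (X 0) S (Pr π : Measure Ω) ∧
        MemLp (Y 0) 2 (Pr π : Measure Ω) ∧ 0 < Var[Y 0; (Pr π : Measure Ω)] ∧
        (∀ N, AEMeasurable (xiHat N) (Pr π : Measure Ω)) ∧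
        TendstoInMeasure (Pr π : Measure Ω) xiHat atTop
          (fun _ => Var[Y 0; (Pr π : Measure Ω)])) →
      (∀ π ∈ nullHypothesis Θ,
        TendstoInDistribution (glmStatistic nrm X Y xiHat) atTop (fun ω' => nrm (W ω'))
          (fun _ => (Pr π : Measure Ω)) μ') ∧
      AsymptoticallyPivotal Pr (nullHypothesis Θ) (glmStatistic nrm X Y xiHat)) := by
  have iid : ∀ (μ : Measure Ω) [IsProbabilityMeasure μ] (θ φ ξ : ℝ),
      IsIIDExpSample F θ φ X Y μ → HasCovMatrix (X 0) S μ →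
      MemLp (Y 0) 2 μ → Var[Y 0; μ] = ξ → 0 < ξ → (∀ N, AEMeasurable (xiHat N) μ) →
      TendstoInMeasure μ xiHat atTop (fun _ => ξ) →
      TendstoInDistribution (glmStatistic nrm X Y xiHat) atTop (fun ω' => nrm (W ω'))
        (fun _ => μ) μ' := by
    intro μ _ θ φ ξ h hX hY hvar hξ hmeas hxi
    exact tendstoInDistribution_glmStatistic nrm hS.posSemidef hW h.indep h.ident_covariates
      h.identDistrib_response h.indep_covariates_response hX hY hvar hξ hmeas hxi
  refine ⟨iid, fun g Θ Pr hglm hnull => ?_⟩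
  have hconv : ∀ π ∈ nullHypothesis Θ,
      TendstoInDistribution (glmStatistic nrm X Y xiHat) atTop (fun ω' => nrm (W ω'))
        (fun _ => (Pr π : Measure Ω)) μ' := by
    intro π hπ
    obtain ⟨hX, hY, hpos, hmeas, hxi⟩ := hnull π hπ
    obtain ⟨θ, hθ⟩ := (hglm π hπ.1).exists_isIIDExpSample hπ.2
    -- The parameter `θ` and the variance may vary with `π`; the limit does not involve them.
    exact iid _ θ _ _ hθ hX hY rfl hpos hmeas hxi
  have hlim : AEMeasurable (fun ω' => nrm (W ω')) μ' :=
    nrm.continuous_euclideanSpace.measurable.comp_aemeasurable hW.aemeasurable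
  let ρ : ProbabilityMeasure ℝ :=
    ⟨μ'.map fun ω' => nrm (W ω'), Measure.isProbabilityMeasure_map hlim⟩
  refine ⟨hconv, ρ, fun π hπ => ⟨(hconv π hπ).forall_aemeasurable, aemeasurable_id, ?_⟩⟩
  have hid : (⟨(ρ : Measure ℝ).map fun x => x,
      Measure.isProbabilityMeasure_map aemeasurable_id⟩ : ProbabilityMeasure ℝ) = ρ :=
    Subtype.ext Measure.map_id
  rw [hid]
  exact (hconv π hπ).tendsto
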